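/- Let $X$ be a (real or complex) Banach space and let $\{U(t,\tau)\}_{t\ge\tau}$, $t,\tau\in\mathbb R$, be a strongly continuous exponentially bounded evolution family on $X$: the operators $U(t,\tau)\in\mathcal L(X)$ satisfy $U(t,t)=I$ and $U(t,\tau)=U(t,s)U(s,\tau)$ for $t\ge s\ge\tau$, the map $(t,\tau)\mapsto U(t,\tau)x$ is continuous on $\{t\ge\tau\}$ for every $x\in X$, and $\|U(t,\tau)\|\le Ce^{\omega(t-\tau)}$ for all $t\ge\tau$ and some constants $C,\omega\in\mathbb R$. Let $$D:(x_n)_{n\in\mathbb Z}\mapsto(x_n-U(n,n-1)x_{n-1})_{n\in\mathbb Z}$$ be the associated difference operator, acting on $\ell_p(\mathbb Z;X)$ for some $p\in[1,\infty)$, or on the space $c_0(\mathbb Z;X)$ of sequences vanishing at $\pm\infty$. For $J\subseteq\mathbb Z$, the family $\{U(n,m)\}_{n\ge m}$ has the exponential dichotomy $\{P_n\}_{n\in J}$ on $J$ if the $P_n$ are bounded projections on $X$ and there are $M\ge1$, $\alpha>0$ such that for all $n\ge m$ in $J$: $U(n,m)P_m=P_nU(n,m)$; the restriction $U(n,m)|_{\ker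 P_m}$ is invertible from $\ker P_m$ to $\ker P_n$; and $\|U(n,m)|_{\operatorname{Im}P_m}\|\le Me^{-\alpha(n-m)}$, $\|(U(n,m)|_{\ker P_m})^{-1}\|\le Me^{-\alpha(n-m)}$. Let $a\le b$ be integers and suppose that $\{U(n,m)\}_{n\ge m}$ has exponential dichotomies $\{P^+_n\}_{n\ge b}$ on $\mathbb Z\cap[b,\infty)$ and $\{P^-_n\}_{n\le a}$ on $\mathbb Z\cap(-\infty,a]$ (in particular, $a=b=0$ is allowed). If $D$ is Fredholm on $\ell_p(\mathbb Z;X)$, $p\in[1,\infty)$, or on $c_0(\mathbb Z;X)$, then for all integers $n\ge b$ and $m\le a$ the discrete node operator $$N(n,m)=(I-P^+_n)\,U(n,m)|_{\ker P^-_m}:\ \ker P^-_m\to\ker P^+_n$$ is Fredholm, and $$\dim\ker D=\dim\ker N(n,m),\qquad \operatorname{codim}\operatorname{Im}D=\operatorname{codim}\operatorname{Im}N(n,m),\qquad \operatorname{ind}D=\operatorname{ind}N(n,m).$$ -/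

import Mathlib

open scoped ENNReal ZeroAtInfty
open Filter Topology

/-- A strongly continuous exponentially bounded evolution family `U (t, τ)`, `t ≥ τ` in `ℝ`, of
bounded operators on `X`. The values `U t τ` with `t < τ` are irrelevant. -/
structure EvolutionFamily (𝕜 X : Type*) [RCLike 𝕜] [NormedAddCommGroup X] [NormedSpace 𝕜 X] where
  /-- The operator `U (t, τ)`. -/
  U : ℝ → ℝ → X →L[𝕜] X
  strongly_continuous : ∀ x : X,
    ContinuousOn (fun q : ℝ × ℝ => U q.1 q.2 x) {q : ℝ × ℝ | q.2 ≤ q.1}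
  exp_bounded : ∃ ω C : ℝ, ∀ t τ : ℝ, τ ≤ t → ‖U t τ‖ ≤ C * Real.exp (ω * (t - τ))
  refl : ∀ t : ℝ, U t t = ContinuousLinearMap.id 𝕜 X
  comp : ∀ t s τ : ℝ, s ≤ t → τ ≤ s → U t τ = (U t s).comp (U s τ)

section Discrete

variable {𝕜 X : Type*} [RCLike 𝕜] [NormedAddCommGroup X] [NormedSpace 𝕜 X]

/-- The discrete evolution family `U (n, m)`, `n ≥ m` in `ℤ`. -/
def EvolutionFamily.discrete (E : EvolutionFamily 𝕜 X) (n m : ℤ) : X →L[𝕜] X :=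
  E.U (n : ℝ) (m : ℝ)

theorem EvolutionFamily.exists_step_bound (E : EvolutionFamily 𝕜 X) :
    ∃ C : ℝ, 0 ≤ C ∧ ∀ (n : ℤ) (x : X), ‖E.discrete n (n - 1) x‖ ≤ C * ‖x‖ := by
  obtain ⟨ω, C, h⟩ := E.exp_bounded
  have key : ∀ n : ℤ, ‖E.discrete n (n - 1)‖ ≤ C * Real.exp ω := by
    intro n
    have h1 := h (n : ℝ) ((n - 1 : ℤ) : ℝ) (by push_cast; linarith)
    have h2 : ω * ((n : ℝ) - ((n - 1 : ℤ) : ℝ)) = ω := by push_cast; ring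
    rw [h2] at h1
    exact h1
  exact ⟨C * Real.exp ω, (norm_nonneg _).trans (key 0),
    fun n x => (E.discrete n (n - 1)).le_of_opNorm_le (key n) x⟩

/-- The sequence `n ↦ x n - U (n, n - 1) x (n - 1)`. -/
def EvolutionFamily.diffSeq (E : EvolutionFamily 𝕜 X) (x : ℤ → X) (n : ℤ) : X :=
  x n - E.discrete n (n - 1) (x (n - 1))

/-! ### The difference operator on `ℓ_p(ℤ; X)` and on `c_0(ℤ; X)` -/

theorem EvolutionFamily.shift_bound (E : EvolutionFamily 𝕜 X) {p : ℝ≥0∞} [Fact (1 ≤ p)]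
    (hp : p ≠ ∞) {C : ℝ} (hC : 0 ≤ C)
    (h : ∀ (n : ℤ) (x : X), ‖E.discrete n (n - 1) x‖ ≤ C * ‖x‖)
    (x : lp (fun _ : ℤ => X) p) (s : Finset ℤ) :
    ∑ n ∈ s, ‖E.discrete n (n - 1) (x (n - 1))‖ ^ p.toReal ≤ (C * ‖x‖) ^ p.toReal := by
  have hp0 : 0 < p.toReal :=
    ENNReal.toReal_pos (zero_lt_one.trans_le (Fact.out : 1 ≤ p)).ne' hp
  have h1 : ∀ n ∈ s, ‖E.discrete n (n - 1) (x (n - 1))‖ ^ p.toReal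
      ≤ C ^ p.toReal * ‖x (n - 1)‖ ^ p.toReal := by
    intro n _
    rw [← Real.mul_rpow hC (norm_nonneg _)]
    exact Real.rpow_le_rpow (norm_nonneg _) (h n _) hp0.le
  have h2 : ∑ n ∈ s, ‖x (n - 1)‖ ^ p.toReal ≤ ‖x‖ ^ p.toReal := by
    have := lp.sum_rpow_le_norm_rpow hp0 x (s.map (Equiv.subRight (1 : ℤ)).toEmbedding)
    simpa [Finset.sum_map] using this
  calc _ ≤ ∑ n ∈ s, C ^ p.toReal * ‖x (n - 1)‖ ^ p.toReal := Finset.sum_le_sum h1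
    _ = C ^ p.toReal * ∑ n ∈ s, ‖x (n - 1)‖ ^ p.toReal := by rw [Finset.mul_sum]
    _ ≤ C ^ p.toReal * ‖x‖ ^ p.toReal :=
        mul_le_mul_of_nonneg_left h2 (Real.rpow_nonneg hC _)
    _ = _ := (Real.mul_rpow hC (norm_nonneg _)).symm

theorem EvolutionFamily.memℓp_shift (E : EvolutionFamily 𝕜 X) {p : ℝ≥0∞} [Fact (1 ≤ p)]
    (hp : p ≠ ∞) (x : lp (fun _ : ℤ => X) p) :
    Memℓp (fun n : ℤ => E.discrete n (n - 1) (x (n - 1))) p := by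
  obtain ⟨C, hC, h⟩ := E.exists_step_bound
  exact memℓp_gen' (E.shift_bound hp hC h x)

theorem EvolutionFamily.memℓp_diffSeq (E : EvolutionFamily 𝕜 X) {p : ℝ≥0∞} [Fact (1 ≤ p)]
    (hp : p ≠ ∞) (x : lp (fun _ : ℤ => X) p) : Memℓp (E.diffSeq x) p :=
  (lp.memℓp x).sub (E.memℓp_shift hp x)

/-- The difference operator `D` on `ℓ_p(ℤ; X)`, `1 ≤ p < ∞`. -/
noncomputable def EvolutionFamily.lpDiff (E : EvolutionFamily 𝕜 X) (p : ℝ≥0∞) [Fact (1 ≤ p)]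
    (hp : p ≠ ∞) : lp (fun _ : ℤ => X) p →L[𝕜] lp (fun _ : ℤ => X) p where
  toFun x := ⟨E.diffSeq x, E.memℓp_diffSeq hp x⟩
  map_add' x y := by
    ext n
    simp only [diffSeq, lp.coeFn_add, Pi.add_apply, map_add]
    abel
  map_smul' c x := by
    ext n
    simp only [diffSeq, lp.coeFn_smul, Pi.smul_apply, map_smul, RingHom.id_apply, smul_sub]
  cont := by
    obtain ⟨C, hC, h⟩ := E.exists_step_bound
    have hp0 : 0 < p.toReal :=
      ENNReal.toReal_pos (zero_lt_one.trans_le (Fact.out : 1 ≤ p)).ne' hp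
    let T : lp (fun _ : ℤ => X) p →ₗ[𝕜] lp (fun _ : ℤ => X) p :=
      { toFun := fun x => ⟨fun n : ℤ => E.discrete n (n - 1) (x (n - 1)), E.memℓp_shift hp x⟩
        map_add' := fun x y => by
          ext n
          simp only [lp.coeFn_add, Pi.add_apply, map_add]
        map_smul' := fun c x => by
          ext n
          simp only [lp.coeFn_smul, Pi.smul_apply, map_smul, RingHom.id_apply] }
    have hT : Continuous T := AddMonoidHomClass.continuous_of_bound T C fun x =>
      lp.norm_le_of_forall_sum_le hp0 (mul_nonneg hC (norm_nonneg _)) (E.shift_bound hp hC h x)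
    exact continuous_id.sub hT

theorem EvolutionFamily.lpDiff_apply (E : EvolutionFamily 𝕜 X) (p : ℝ≥0∞) [Fact (1 ≤ p)]
    (hp : p ≠ ∞) (x : lp (fun _ : ℤ => X) p) (n : ℤ) :
    E.lpDiff p hp x n = x n - E.discrete n (n - 1) (x (n - 1)) := rfl

theorem EvolutionFamily.tendsto_diffSeq (E : EvolutionFamily 𝕜 X) (x : C₀(ℤ, X)) :
    Tendsto (E.diffSeq x) (cocompact ℤ) (𝓝 0) := by
  obtain ⟨C, hC, h⟩ := E.exists_step_bound
  have hx : Tendsto x (cocompact ℤ) (𝓝 0) := zero_at_infty x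
  have hs : Tendsto (fun n : ℤ => x (n - 1)) (cocompact ℤ) (𝓝 0) :=
    hx.comp (Homeomorph.subRight (1 : ℤ)).isClosedEmbedding.tendsto_cocompact
  have hb : Tendsto (fun n : ℤ => C * ‖x (n - 1)‖) (cocompact ℤ) (𝓝 0) := by
    simpa using hs.norm.const_mul C
  have ht := hx.sub (squeeze_zero_norm (fun n : ℤ => h n (x (n - 1))) hb)
  rw [sub_zero] at ht
  exact ht

/-- The difference operator `D` on `c_0(ℤ; X)`, the space of sequences vanishing at `±∞`. -/
noncomputable def EvolutionFamily.c0Diff (E : EvolutionFamily 𝕜 X) :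
    C₀(ℤ, X) →L[𝕜] C₀(ℤ, X) where
  toFun x := ⟨⟨E.diffSeq x, continuous_of_discreteTopology⟩, E.tendsto_diffSeq x⟩
  map_add' x y := by
    ext n
    change (x n + y n) - E.discrete n (n - 1) (x (n - 1) + y (n - 1)) =
      (x n - E.discrete n (n - 1) (x (n - 1))) + (y n - E.discrete n (n - 1) (y (n - 1)))
    rw [map_add]
    abel
  map_smul' c x := by
    ext n
    change c • x n - E.discrete n (n - 1) (c • x (n - 1)) =
      c • (x n - E.discrete n (n - 1) (x (n - 1)))
    rw [map_smul, smul_sub]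
  cont := by
    obtain ⟨C, hC, h⟩ := E.exists_step_bound
    refine continuous_of_linear_of_bound (𝕜 := 𝕜) (C := 1 + C) ?_ ?_ ?_
    · intro x y
      ext n
      change (x n + y n) - E.discrete n (n - 1) (x (n - 1) + y (n - 1)) =
        (x n - E.discrete n (n - 1) (x (n - 1))) + (y n - E.discrete n (n - 1) (y (n - 1)))
      rw [map_add]
      abel
    · intro c x
      ext n
      change c • x n - E.discrete n (n - 1) (c • x (n - 1)) =
        c • (x n - E.discrete n (n - 1) (x (n - 1)))
      rw [map_smul, smul_sub]
    · intro x
      rw [← ZeroAtInftyContinuousMap.norm_toBCF_eq_norm]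
      refine (BoundedContinuousFunction.norm_le
        (mul_nonneg (by linarith) (norm_nonneg _))).2 fun n => ?_
      have hx : ∀ k : ℤ, ‖x k‖ ≤ ‖x‖ := fun k => x.toBCF.norm_coe_le_norm k
      calc ‖x n - E.discrete n (n - 1) (x (n - 1))‖
          ≤ ‖x n‖ + ‖E.discrete n (n - 1) (x (n - 1))‖ := norm_sub_le _ _
        _ ≤ ‖x‖ + C * ‖x‖ := add_le_add (hx n)
            ((h n _).trans (mul_le_mul_of_nonneg_left (hx _) hC))
        _ = (1 + C) * ‖x‖ := by ring

theorem EvolutionFamily.c0Diff_apply (E : EvolutionFamily 𝕜 X) (x : C₀(ℤ, X)) (n : ℤ) :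
    E.c0Diff x n = x n - E.discrete n (n - 1) (x (n - 1)) := rfl

/-! ### Exponential dichotomies and node operators -/

/-- The discrete family `V (n, m)`, `n ≥ m`, has the exponential dichotomy `P n`, `n ∈ J`, on
`J ⊆ ℤ`. The values `P n` with `n ∉ J` are irrelevant. -/
structure IsExpDichotomyOn (V : ℤ → ℤ → X →L[𝕜] X) (J : Set ℤ) (P : ℤ → X →L[𝕜] X) : Prop where
  isIdempotentElem : ∀ n ∈ J, IsIdempotentElem (P n)
  intertwining : ∀ n ∈ J, ∀ m ∈ J, m ≤ n → (V n m).comp (P m) = (P n).comp (V n m)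
  invertible : ∀ n ∈ J, ∀ m ∈ J, m ≤ n → Set.BijOn (V n m) {x | P m x = 0} {x | P n x = 0}
  estimates : ∃ M α : ℝ, 1 ≤ M ∧ 0 < α ∧ ∀ n ∈ J, ∀ m ∈ J, m ≤ n →
    -- the stable estimate, on the range of `P m`
    (∀ x : X, P m x = x → ‖V n m x‖ ≤ M * Real.exp (-α * ((n : ℝ) - m)) * ‖x‖) ∧
    -- the unstable estimate: norm bound of the inverse of `V n m : ker (P m) → ker (P n)`
    (∀ x : X, P m x = 0 → ‖x‖ ≤ M * Real.exp (-α * ((n : ℝ) - m)) * ‖V n m x‖)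

/-- The node operator `N (n, m) = (I - Pplus n) V (n, m)` restricted to `ker (Pminus m)`, acting
from `ker (Pminus m)` to `ker (Pplus n)`, where `Pplus n` is a projection. -/
noncomputable def nodeOperator (V : ℤ → ℤ → X →L[𝕜] X) (Pplus Pminus : ℤ → X →L[𝕜] X) (n m : ℤ)
    (hn : IsIdempotentElem (Pplus n)) : (Pminus m).ker →L[𝕜] (Pplus n).ker :=
  (((ContinuousLinearMap.id 𝕜 X - Pplus n).comp (V n m)).comp (Pminus m).ker.subtypeL).codRestrict
    (Pplus n).ker (by
      intro x
      have h : ∀ y : X, Pplus n (Pplus n y) = Pplus n y :=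
        fun y => congrArg (fun T : X →L[𝕜] X => T y) hn
      simp [h])

theorem nodeOperator_apply (V : ℤ → ℤ → X →L[𝕜] X) (Pplus Pminus : ℤ → X →L[𝕜] X) (n m : ℤ)
    (hn : IsIdempotentElem (Pplus n)) (x : (Pminus m).ker) :
    (nodeOperator V Pplus Pminus n m hn x : X) = V n m x - Pplus n (V n m x) := rfl

end Discrete

section Defects

variable {𝕜 V W : Type*} [RCLike 𝕜] [NormedAddCommGroup V] [NormedSpace 𝕜 V]
  [NormedAddCommGroup W] [NormedSpace 𝕜 W]

/-- `dim ker T`; used for Fredholm operators only, where it is finite. -/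
noncomputable def dimKer (T : V →L[𝕜] W) : ℕ := Module.finrank 𝕜 T.ker

/-- `codim Im T`; used for Fredholm operators only, where it is finite. -/
noncomputable def codimRange (T : V →L[𝕜] W) : ℕ := Module.finrank 𝕜 (W ⧸ T.range)

/-- The Fredholm index `dim ker T - codim Im T`. -/
noncomputable def fredholmIndex (T : V →L[𝕜] W) : ℤ := (dimKer T : ℤ) - (codimRange T : ℤ)

/-- `S` and `T` have the same kernel dimension, range codimension and Fredholm index. -/
def SameDefects {V' W' : Type*} [NormedAddCommGroup V'] [NormedSpace 𝕜 V']
    [NormedAddCommGroup W'] [NormedSpace 𝕜 W'] (S : V →L[𝕜] W) (T : V' →L[𝕜] W') : Prop :=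
  dimKer S = dimKer T ∧ codimRange S = codimRange T ∧ fredholmIndex S = fredholmIndex T

end Defects

/-!
Put `N = N (n, m)`. Both the kernel and the cokernel of `N` are identified with those of `D` by
explicit algebraic isomorphisms, so that no perturbation theory of Fredholm operators is needed.

* *Kernels.* A bounded solution of `x k = U (k, k - 1) x (k - 1)` has its value at `m` in
  `ker (Pminus m)`, because the stable component would grow exponentially backward in time, and its
  value at `n` in the range of `Pplus n`, because the unstable component would grow exponentially
  forward. Hence `x ↦ x m` maps `ker D` into `ker N`. Conversely a vector of `ker N` has a forward
  and a backward orbit which decay exponentially (`nonempty_ker_equiv_ker_nodeOperator`).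
* *Cokernels.* For `z` in `ker (Pplus n)` let `ι z` be the sequence supported at `n + 1` with value
  `U (n + 1, n) z`. Solving `D x = ι z` amounts to finding an unstable vector `w` at time `m` such
  that `U (n, m) w + z` is stable at time `n`, that is, `N w = -z`. Moreover every `y` is in the
  range of `D` modulo the range of `ι`: both half-lines have a Green function
  (`IsExpDichotomyOn.exists_admissible_solution`), and the unstable part of the mismatch of the two
  half-line solutions at time `n` is corrected by a suitable `ι z`
  (`nonempty_coker_nodeOperator_equiv_coker`).

Since `ker (Pminus m)` and `ker (Pplus n)` are Banach spaces, finite dimension of kernel and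
cokernel of `N` suffices for `N` to be Fredholm.

The sequence space enters only through a few properties of the class of scalar sequences `‖x ·‖`,
collected in `IsAdmissibleClass`: it contains the sequences decaying geometrically in `|k|`, and it
is stable under convolution with geometric kernels. Both `ℓ_p`, `p < ∞`, and `c_0` have them. The
norm bound of the Green function uses that the projections of a dichotomy are uniformly bounded,
which is not part of the definition and follows from the exponential bound on the family
(`IsExpDichotomyOn.exists_proj_bound`).
-/

/-! ### Fredholm operators between Banach spaces -/

/-- Between Banach spaces, an operator with finite dimensional kernel and cokernel is Fredholm:
by the open mapping theorem it restricts to an isomorphism from a closed complement of the kernel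
onto the range. -/
theorem ContinuousLinearMap.isFredholm_of_finite_ker_of_finite_coker {𝕜 V W : Type*} [RCLike 𝕜]
    [NormedAddCommGroup V] [NormedSpace 𝕜 V] [CompleteSpace V]
    [NormedAddCommGroup W] [NormedSpace 𝕜 W] [CompleteSpace W] (T : V →L[𝕜] W)
    (hker : FiniteDimensional 𝕜 T.ker) (hcoker : T.range.CoFG) : T.IsFredholm := by
  obtain ⟨K, hKclosed, hK⟩ :=
    (Submodule.ClosedComplemented.of_finiteDimensional T.ker).exists_isClosed_isCompl
  have hKquot : K.CoFG := Module.Finite.equiv (Submodule.quotientEquivOfIsCompl K T.ker hK.symm).symm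
  have : CompleteSpace K := hKclosed.completeSpace_coe
  have hinj : (T.domRestrict K).ker = ⊥ := by
    rw [LinearMap.ker_eq_bot']
    intro x hx
    have hxK : (x : V) ∈ T.ker ⊓ K := ⟨hx, x.2⟩
    rw [hK.inf_eq_bot] at hxK
    exact Subtype.ext hxK
  have hrange : (T.domRestrict K).range = T.range := by
    refine le_antisymm ?_ ?_
    · rintro _ ⟨x, rfl⟩
      exact ⟨x, rfl⟩
    · rintro _ ⟨x, rfl⟩
      obtain ⟨u, hu, v, hv, rfl⟩ :=
        Submodule.mem_sup.1 (hK.sup_eq_top ▸ Submodule.mem_top : x ∈ T.ker ⊔ K)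
      refine ⟨⟨v, hv⟩, ?_⟩
      have hu0 : T u = 0 := hu
      change T v = T (u + v)
      rw [map_add, hu0, zero_add]
  obtain ⟨G, hG⟩ := T.range.exists_isCompl
  have hGfin : FiniteDimensional 𝕜 G :=
    Module.Finite.equiv (Submodule.quotientEquivOfIsCompl _ G hG)
  have hclosed : IsClosed (T.range : Set W) := by
    rw [← hrange]
    exact (T.domRestrict K).closed_complemented_range_of_isCompl_of_ker_eq_bot G
      (by rw [hrange]; exact hG) (Submodule.closed_of_finiteDimensional G) hinj
  have : CompleteSpace T.range := hclosed.completeSpace_coe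
  have hmaps : Set.MapsTo T K T.range := fun x _ => ⟨x, rfl⟩
  refine ContinuousLinearMap.IsFredholm.of_isInvertible_restrict hKclosed hclosed hmaps ?_
  refine ⟨ContinuousLinearEquiv.ofBijective (T.restrict hmaps) ?_ ?_, ?_⟩
  · rw [LinearMap.ker_eq_bot'] at hinj ⊢
    intro x hx
    exact hinj x (congrArg Subtype.val hx)
  · rw [LinearMap.range_eq_top]
    rintro ⟨y, hy⟩
    obtain ⟨x, hx⟩ := hrange.symm ▸ hy
    exact ⟨x, Subtype.ext hx⟩
  · ext x
    simp

/-! ### Admissible classes of scalar sequences -/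

/-- A class of scalar sequences, given by a predicate `G`, such that membership is a
growth condition that is stable under convolution with one-sided geometric kernels. A sequence
`x : ℤ → X` is measured by whether `‖x ·‖` belongs to the class. The classes of interest are `ℓ_p`,
`p < ∞`, and `c_0`. -/
structure IsAdmissibleClass (G : (ℤ → ℝ) → Prop) : Prop where
  mono : ∀ {u v : ℤ → ℝ}, G v → (∀ k, 0 ≤ u k) → (∀ k, u k ≤ v k) → G u
  add : ∀ {u v : ℤ → ℝ}, G u → G v → G (fun k => u k + v k)
  const_mul : ∀ {u : ℤ → ℝ} (c : ℝ), G u → G (fun k => c * u k)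
  bounded : ∀ {u : ℤ → ℝ}, G u → ∃ B, 0 ≤ B ∧ ∀ k, |u k| ≤ B
  comp_neg : ∀ {u : ℤ → ℝ}, G u → G (fun k => u (-k))
  single : ∀ j : ℤ, G (Pi.single j 1)
  conv : ∀ {u : ℤ → ℝ} {r : ℝ}, G u → (∀ k, 0 ≤ u k) → 0 < r → r < 1 →
    G (fun k => ∑' i : ℕ, r ^ i * u (k - i))

theorem summable_geometric_mul_of_bounded {r B : ℝ} (hr0 : 0 < r) (hr1 : r < 1) {f : ℕ → ℝ}
    (hf : ∀ i, |f i| ≤ B) : Summable fun i : ℕ => r ^ i * f i := by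
  refine Summable.of_norm_bounded
    ((summable_geometric_of_lt_one hr0.le hr1).mul_right B) fun i => ?_
  rw [norm_mul, Real.norm_eq_abs, Real.norm_eq_abs, abs_of_nonneg (pow_nonneg hr0.le i)]
  exact mul_le_mul_of_nonneg_left (hf i) (pow_nonneg hr0.le i)

namespace IsAdmissibleClass

variable {G : (ℤ → ℝ) → Prop}

theorem zero (hG : IsAdmissibleClass G) : G 0 :=
  hG.mono (hG.single 0) (fun _ => le_rfl) fun k => by
    by_cases h : k = 0 <;> simp [h]

theorem sum_single (hG : IsAdmissibleClass G) (c : ℤ → ℝ) (s : Finset ℤ) :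
    G (fun k => ∑ j ∈ s, c j * (Pi.single j 1 : ℤ → ℝ) k) := by
  induction s using Finset.induction_on with
  | empty => exact hG.zero
  | insert a s ha ih =>
    simp_rw [Finset.sum_insert ha]
    exact hG.add (hG.const_mul (c a) (hG.single a)) ih

theorem conv_forward (hG : IsAdmissibleClass G) {u : ℤ → ℝ} {r : ℝ} (hu : G u)
    (hu0 : ∀ k, 0 ≤ u k) (hr0 : 0 < r) (hr1 : r < 1) :
    G (fun k => ∑' i : ℕ, r ^ i * u (k + i)) := by
  have h := hG.comp_neg (hG.conv (hG.comp_neg hu) (fun k => hu0 (-k)) hr0 hr1)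
  refine (congrArg G (funext fun k => tsum_congr fun i => ?_)).mp h
  congr 2
  ring

theorem geometric (hG : IsAdmissibleClass G) {r : ℝ} (hr0 : 0 < r) (hr1 : r < 1) (n : ℤ) :
    G (fun k => r ^ (k - n).natAbs) := by
  have hb : ∀ k : ℤ, |(Pi.single n 1 : ℤ → ℝ) k| ≤ 1 := fun k => by
    by_cases h : k = n <;> simp [h]
  have hs0 : ∀ k : ℤ, 0 ≤ (Pi.single n 1 : ℤ → ℝ) k := fun k => by
    by_cases h : k = n <;> simp [h]
  have h0 : ∀ (i : ℕ) (k : ℤ), 0 ≤ r ^ i * (Pi.single n 1 : ℤ → ℝ) k := fun i k =>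
    mul_nonneg (pow_nonneg hr0.le _) (hs0 k)
  refine hG.mono (hG.add (hG.conv (hG.single n) hs0 hr0 hr1)
    (hG.conv_forward (hG.single n) hs0 hr0 hr1)) (fun k => by positivity) fun k => ?_
  have h1 : 0 ≤ ∑' i : ℕ, r ^ i * (Pi.single n 1 : ℤ → ℝ) (k - i) := tsum_nonneg fun i => h0 _ _
  have h2 : 0 ≤ ∑' i : ℕ, r ^ i * (Pi.single n 1 : ℤ → ℝ) (k + i) := tsum_nonneg fun i => h0 _ _
  rcases le_total n k with h | h
  · have := (summable_geometric_mul_of_bounded hr0 hr1 fun i : ℕ => hb (k - i)).le_tsum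
      (k - n).natAbs fun i _ => h0 _ _
    have e : k - ((k - n).natAbs : ℤ) = n := by omega
    rw [e, Pi.single_eq_same, mul_one] at this
    linarith
  · have := (summable_geometric_mul_of_bounded hr0 hr1 fun i : ℕ => hb (k + i)).le_tsum
      (k - n).natAbs fun i _ => h0 _ _
    have e : k + ((k - n).natAbs : ℤ) = n := by omega
    rw [e, Pi.single_eq_same, mul_one] at this
    linarith

end IsAdmissibleClass

theorem isAdmissibleClass_c0 :
    IsAdmissibleClass fun u : ℤ → ℝ => Tendsto u cofinite (𝓝 0) where
  mono hv h0 h := squeeze_zero h0 h hv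
  add hu hv := by simpa using hu.add hv
  const_mul c hu := by simpa using hu.const_mul c
  bounded {u} hu := by
    obtain ⟨B, hB⟩ := hu.norm.bddAbove_range_of_cofinite
    exact ⟨B, (norm_nonneg _).trans (hB ⟨0, rfl⟩), fun k => hB ⟨k, rfl⟩⟩
  comp_neg hu := hu.comp neg_injective.tendsto_cofinite
  single j := by
    refine tendsto_nhds_of_eventually_eq ?_
    have : {j}ᶜ ∈ (cofinite : Filter ℤ) := (Set.finite_singleton j).compl_mem_cofinite
    filter_upwards [this] with k hk
    exact Pi.single_eq_of_ne hk _
  conv {u r} hu _ hr0 hr1 := by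
    obtain ⟨B, hB⟩ := hu.norm.bddAbove_range_of_cofinite
    have hlim : ∀ i : ℕ, Tendsto (fun k : ℤ => r ^ i * u (k - i)) cofinite (𝓝 0) := fun i => by
      simpa using (hu.comp (sub_left_injective (b := (i : ℤ))).tendsto_cofinite).const_mul (r ^ i)
    have := tendsto_tsum_of_dominated_convergence (𝓕 := (cofinite : Filter ℤ))
      (f := fun (k : ℤ) (i : ℕ) => r ^ i * u (k - i)) (g := fun _ : ℕ => (0 : ℝ))
      ((summable_geometric_of_lt_one hr0.le hr1).mul_right B) hlim
      (Eventually.of_forall fun k i => by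
        rw [norm_mul, Real.norm_eq_abs (r ^ i), abs_of_nonneg (pow_nonneg hr0.le i)]
        exact mul_le_mul_of_nonneg_left (hB ⟨_, rfl⟩) (pow_nonneg hr0.le i))
    simpa using this

/-- A bounded nonnegative sequence with `a k ≤ r * a (k - 1) + b k`, `r < 1` and `b` summable is
summable: over `[-K, K]` the sums of `a` and of its shift differ by at most one term. -/
theorem summable_of_le_mul_shift_add {a b : ℤ → ℝ} {r B : ℝ} (hr0 : 0 < r) (hr1 : r < 1)
    (ha0 : ∀ k, 0 ≤ a k) (haB : ∀ k, a k ≤ B) (hb0 : ∀ k, 0 ≤ b k) (hb : Summable b)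
    (h : ∀ k, a k ≤ r * a (k - 1) + b k) : Summable a := by
  refine summable_of_sum_le (c := (r * B + ∑' k, b k) / (1 - r)) ha0 fun s => ?_
  obtain ⟨K, hK⟩ : ∃ K : ℤ, s ⊆ Finset.Icc (-K) K := by
    refine ⟨∑ j ∈ s, |j|, fun k hk => ?_⟩
    have := Finset.single_le_sum (f := fun j : ℤ => |j|) (fun j _ => abs_nonneg j) hk
    exact Finset.mem_Icc.2 (abs_le.1 this)
  refine (Finset.sum_le_sum_of_subset_of_nonneg hK fun k _ _ => ha0 k).trans ?_
  rw [le_div_iff₀ (by linarith)]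
  have hshift : ∑ k ∈ Finset.Icc (-K) K, a (k - 1) ≤ ∑ k ∈ Finset.Icc (-K) K, a k + B := by
    have e : ∑ k ∈ Finset.Icc (-K) K, a (k - 1)
        = ∑ k ∈ (Finset.Icc (-K) K).map (Equiv.subRight (1 : ℤ)).toEmbedding, a k := by
      simp [Finset.sum_map]
    have hsub : (Finset.Icc (-K) K).map (Equiv.subRight (1 : ℤ)).toEmbedding
        ⊆ insert (-K - 1) (Finset.Icc (-K) K) := by
      intro k hk
      simp only [Finset.mem_map_equiv, Finset.mem_Icc, Finset.mem_insert, Equiv.subRight_symm_apply]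
        at hk ⊢
      omega
    rw [e]
    refine (Finset.sum_le_sum_of_subset_of_nonneg hsub fun k _ _ => ha0 k).trans ?_
    rw [Finset.sum_insert (by simp)]
    linarith [haB (-K - 1)]
  have hsum : ∑ k ∈ Finset.Icc (-K) K, a k
      ≤ r * ∑ k ∈ Finset.Icc (-K) K, a (k - 1) + ∑ k ∈ Finset.Icc (-K) K, b k := by
    rw [Finset.mul_sum, ← Finset.sum_add_distrib]
    exact Finset.sum_le_sum fun k _ => h k
  have := hb.sum_le_tsum (Finset.Icc (-K) K) fun k _ => hb0 k
  nlinarith [mul_le_mul_of_nonneg_left hshift hr0.le]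

/-- The geometric convolution `v` of `u` satisfies `v k = r * v (k - 1) + u k`, and convexity of
`t ↦ t ^ p` turns this into a recursive inequality for `v ^ p`. -/
theorem isAdmissibleClass_lp {p : ℝ≥0∞} (hp1 : 1 ≤ p) (hp : p ≠ ∞) :
    IsAdmissibleClass fun u : ℤ → ℝ => Memℓp u p := by
  have hpr : 1 ≤ p.toReal := by simpa using ENNReal.toReal_mono hp hp1
  have hp0 : 0 < p.toReal := by linarith
  refine ⟨?_, Memℓp.add, fun c hu => hu.const_mul c, ?_, ?_, ?_, ?_⟩
  · intro u v hv h0 h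
    rw [memℓp_gen_iff hp0] at hv ⊢
    refine hv.of_nonneg_of_le (fun k => by positivity) fun k => ?_
    refine Real.rpow_le_rpow (norm_nonneg _) ?_ hp0.le
    rw [Real.norm_of_nonneg (h0 k), Real.norm_of_nonneg ((h0 k).trans (h k))]
    exact h k
  · intro u hu
    obtain ⟨B, hB⟩ := (memℓp_infty_iff.1 (hu.of_exponent_ge le_top))
    exact ⟨B, (norm_nonneg _).trans (hB ⟨0, rfl⟩), fun k => hB ⟨k, rfl⟩⟩
  · intro u hu
    rw [memℓp_gen_iff hp0] at hu ⊢
    exact hu.comp_injective neg_injective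
  · intro j
    rw [memℓp_gen_iff hp0]
    refine summable_of_ne_finset_zero (s := {j}) fun k hk => ?_
    rw [Pi.single_eq_of_ne (by simpa using hk), norm_zero, Real.zero_rpow hp0.ne']
  · intro u r hu hu0 hr0 hr1
    obtain ⟨B, hB⟩ := (memℓp_infty_iff.1 (hu.of_exponent_ge le_top))
    have hB' : ∀ k, |u k| ≤ B := fun k => hB ⟨k, rfl⟩
    have hB0 : 0 ≤ B := (abs_nonneg _).trans (hB' 0)
    set v : ℤ → ℝ := fun k => ∑' i : ℕ, r ^ i * u (k - i) with hv
    have hsm : ∀ k : ℤ, Summable fun i : ℕ => r ^ i * u (k - i) := fun k =>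
      summable_geometric_mul_of_bounded hr0 hr1 fun i => hB' _
    have hv0 : ∀ k, 0 ≤ v k := fun k => tsum_nonneg fun i => mul_nonneg (by positivity) (hu0 _)
    have hgeo := summable_geometric_of_lt_one hr0.le hr1
    have hvB : ∀ k, v k ≤ ∑' i : ℕ, r ^ i * B := fun k =>
      (hsm k).tsum_le_tsum (fun i => mul_le_mul_of_nonneg_left ((le_abs_self _).trans (hB' _))
        (by positivity)) (hgeo.mul_right B)
    have hrec : ∀ k, v k = r * v (k - 1) + u k := fun k => by
      rw [hv]
      simp only
      rw [(hsm k).tsum_eq_zero_add, ← tsum_mul_left, add_comm]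
      congr 1
      · refine tsum_congr fun i => ?_
        rw [pow_succ']
        push_cast
        rw [mul_assoc, sub_sub, add_comm (1 : ℤ)]
      · simp
    rw [memℓp_gen_iff hp0] at hu ⊢
    simp_rw [Real.norm_of_nonneg (hu0 _)] at hu
    simp_rw [Real.norm_of_nonneg (hv0 _)]
    refine summable_of_le_mul_shift_add (b := fun k => (1 - r) * (u k / (1 - r)) ^ p.toReal)
      hr0 hr1 (fun k => Real.rpow_nonneg (hv0 k) _)
      (fun k => Real.rpow_le_rpow (hv0 k) (hvB k) hp0.le) ?_ ?_ ?_
    · intro k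
      exact mul_nonneg (by linarith)
        (Real.rpow_nonneg (div_nonneg (hu0 k) (by linarith)) _)
    · simp_rw [Real.div_rpow (hu0 _) (by linarith : 0 ≤ 1 - r)]
      exact (hu.div_const _).mul_left _
    · intro k
      have hc := (convexOn_rpow hpr).2 (Set.mem_Ici.2 (hv0 (k - 1)))
        (Set.mem_Ici.2 (div_nonneg (hu0 k) (by linarith : 0 ≤ 1 - r))) hr0.le
        (by linarith : 0 ≤ 1 - r) (by ring)
      simp only [smul_eq_mul] at hc
      rwa [mul_div_cancel₀ _ (by linarith : 1 - r ≠ 0), ← hrec k] at hc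

/-! ### Consequences of an exponential dichotomy -/

section Dichotomy

variable {𝕜 X : Type*} [RCLike 𝕜] [NormedAddCommGroup X] [NormedSpace 𝕜 X]

theorem EvolutionFamily.discrete_self_apply (E : EvolutionFamily 𝕜 X) (n : ℤ) (x : X) :
    E.discrete n n x = x := by
  simp [discrete, E.refl]

theorem EvolutionFamily.discrete_discrete (E : EvolutionFamily 𝕜 X) {n k m : ℤ} (hkn : k ≤ n)
    (hmk : m ≤ k) (x : X) : E.discrete n k (E.discrete k m x) = E.discrete n m x := by
  simp only [discrete]
  rw [E.comp n k m (by exact_mod_cast hkn) (by exact_mod_cast hmk)]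
  rfl

namespace IsExpDichotomyOn

variable {J : Set ℤ} {P : ℤ → X →L[𝕜] X}

theorem mono {V : ℤ → ℤ → X →L[𝕜] X} (h : IsExpDichotomyOn V J P) {J' : Set ℤ} (hJ : J' ⊆ J) :
    IsExpDichotomyOn V J' P where
  isIdempotentElem n hn := h.isIdempotentElem n (hJ hn)
  intertwining n hn m hm := h.intertwining n (hJ hn) m (hJ hm)
  invertible n hn m hm := h.invertible n (hJ hn) m (hJ hm)
  estimates := by
    obtain ⟨M, α, hM, hα, H⟩ := h.estimates
    exact ⟨M, α, hM, hα, fun n hn m hm => H n (hJ hn) m (hJ hm)⟩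

theorem proj_proj {V : ℤ → ℤ → X →L[𝕜] X} (h : IsExpDichotomyOn V J P) {n : ℤ} (hn : n ∈ J)
    (x : X) : P n (P n x) = P n x :=
  congrArg (fun T : X →L[𝕜] X => T x) (h.isIdempotentElem n hn)

theorem proj_comp {V : ℤ → ℤ → X →L[𝕜] X} (h : IsExpDichotomyOn V J P) {n m : ℤ} (hn : n ∈ J)
    (hm : m ∈ J) (hmn : m ≤ n) (x : X) : P n (V n m x) = V n m (P m x) :=
  (congrArg (fun T : X →L[𝕜] X => T x) (h.intertwining n hn m hm hmn)).symm

theorem exists_geometric_estimates {V : ℤ → ℤ → X →L[𝕜] X} (h : IsExpDichotomyOn V J P) :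
    ∃ M r : ℝ, 0 < M ∧ 0 < r ∧ r < 1 ∧ ∀ k ∈ J, ∀ j ∈ J, ∀ i : ℕ, j = k + i →
      (∀ x : X, P k x = x → ‖V j k x‖ ≤ M * r ^ i * ‖x‖) ∧
      (∀ x : X, P k x = 0 → ‖x‖ ≤ M * r ^ i * ‖V j k x‖) := by
  obtain ⟨M, α, hM, hα, H⟩ := h.estimates
  refine ⟨M, Real.exp (-α), by linarith, Real.exp_pos _, (by simpa using hα), ?_⟩
  rintro k hk j hj i rfl
  have e : Real.exp (-α) ^ i = Real.exp (-α * (((k + i : ℤ) : ℝ) - k)) := by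
    rw [← Real.exp_nat_mul]
    congr 1
    push_cast
    ring
  rw [e]
  exact H _ hj k hk (by omega)

/-- The projections of a dichotomy of an exponentially bounded family are uniformly bounded: an
`i`-step evolution, with `i` fixed and large, separates the stable from the unstable component,
while its norm is bounded uniformly. The finitely many `k ∈ J` with `k + i ∉ J` are harmless. -/
theorem exists_proj_bound {E : EvolutionFamily 𝕜 X} (h : IsExpDichotomyOn E.discrete J P)
    (hJ : ∀ i : ℕ, {k : ℤ | k ∈ J ∧ k + i ∉ J}.Finite) :
    ∃ K : ℝ, 0 ≤ K ∧ ∀ k ∈ J, ∀ x : X, ‖P k x‖ ≤ K * ‖x‖ := by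
  obtain ⟨M, r, hM, hr0, hr1, H⟩ := h.exists_geometric_estimates
  obtain ⟨ω, C, hE⟩ := E.exp_bounded
  obtain ⟨i, hi⟩ : ∃ i : ℕ, M * r ^ i < 1 / 4 := by
    obtain ⟨i, hi⟩ := exists_pow_lt_of_lt_one (show 0 < 1 / (4 * M) by positivity) hr1
    refine ⟨i, ?_⟩
    calc M * r ^ i < M * (1 / (4 * M)) := mul_lt_mul_of_pos_left hi hM
      _ = 1 / 4 := by field_simp
  set B : ℝ := C * Real.exp (ω * i) with hB
  have hVB : ∀ k : ℤ, ‖E.discrete (k + i) k‖ ≤ B := fun k => by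
    have := hE ((k + i : ℤ) : ℝ) (k : ℝ) (by push_cast; linarith [Nat.cast_nonneg (α := ℝ) i])
    have e : ((k + i : ℤ) : ℝ) - k = i := by push_cast; ring
    rw [e] at this
    exact this
  have hB0 : 0 ≤ B := (norm_nonneg _).trans (hVB 0)
  set S := (hJ i).toFinset with hS
  have hS0 : 0 ≤ ∑ k ∈ S, ‖P k‖ := Finset.sum_nonneg fun _ _ => norm_nonneg _
  refine ⟨(2 + B) + ∑ k ∈ S, ‖P k‖, by linarith, fun k hk x => ?_⟩
  have hx := norm_nonneg x
  rw [add_mul]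
  by_cases hki : k + i ∈ J
  · have hs := (H k hk _ hki i rfl).1 (P k x) (h.proj_proj hk x)
    have hu := (H k hk _ hki i rfl).2 (x - P k x) (by rw [map_sub, h.proj_proj hk, sub_self])
    have hs' : ‖E.discrete (k + i) k (P k x)‖ ≤ 1 / 4 * ‖P k x‖ :=
      hs.trans (mul_le_mul_of_nonneg_right hi.le (norm_nonneg _))
    have hu' : ‖x - P k x‖ ≤ 1 / 4 * ‖E.discrete (k + i) k (x - P k x)‖ :=
      hu.trans (mul_le_mul_of_nonneg_right hi.le (norm_nonneg _))
    have hV : ‖E.discrete (k + i) k (x - P k x)‖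
        ≤ B * ‖x‖ + ‖E.discrete (k + i) k (P k x)‖ := by
      rw [map_sub]
      exact (norm_sub_le _ _).trans (add_le_add ((E.discrete _ _).le_of_opNorm_le (hVB k) x) le_rfl)
    have ht : ‖P k x‖ ≤ ‖x‖ + ‖x - P k x‖ := by
      calc ‖P k x‖ = ‖x - (x - P k x)‖ := by rw [sub_sub_cancel]
        _ ≤ _ := norm_sub_le _ _
    have h1 : 0 ≤ (∑ k ∈ S, ‖P k‖) * ‖x‖ := mul_nonneg hS0 hx
    have h2 : 0 ≤ B * ‖x‖ := mul_nonneg hB0 hx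
    linarith
  · have hkS : k ∈ S := by simpa [hS] using ⟨hk, hki⟩
    have h1 := (P k).le_opNorm x
    have h2 := mul_le_mul_of_nonneg_right
      (Finset.single_le_sum (f := fun k => ‖P k‖) (fun _ _ => norm_nonneg _) hkS) hx
    have h3 : 0 ≤ (2 + B) * ‖x‖ := by positivity
    linarith

/-- The two halves of the Green function: forward evolution of the stable component, and backward
evolution `R k j` of the unstable component at time `j` to an earlier time `k`, both with
a geometric bound on all of `X`. -/
theorem exists_green_kernel {E : EvolutionFamily 𝕜 X} (h : IsExpDichotomyOn E.discrete J P)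
    (hJ : ∀ i : ℕ, {k : ℤ | k ∈ J ∧ k + i ∉ J}.Finite) :
    ∃ (M r : ℝ) (R : ℤ → ℤ → X → X), 0 < M ∧ 0 < r ∧ r < 1 ∧
      ∀ k ∈ J, ∀ j ∈ J, ∀ i : ℕ, j = k + i → ∀ x : X,
        ‖E.discrete j k (P k x)‖ ≤ M * r ^ i * ‖x‖ ∧
        P k (R k j x) = 0 ∧ E.discrete j k (R k j x) = x - P j x ∧
        ‖R k j x‖ ≤ M * r ^ i * ‖x‖ := by
  obtain ⟨M, r, hM, hr0, hr1, H⟩ := h.exists_geometric_estimates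
  obtain ⟨K, hK0, hK⟩ := h.exists_proj_bound hJ
  have hex : ∀ (k j : ℤ) (x : X), ∃ w, k ∈ J → j ∈ J → k ≤ j →
      P k w = 0 ∧ E.discrete j k w = x - P j x := by
    intro k j x
    by_cases hc : k ∈ J ∧ j ∈ J ∧ k ≤ j
    · obtain ⟨w, hw, hw'⟩ := (h.invertible j hc.2.1 k hc.1 hc.2.2).surjOn
        (show P j (x - P j x) = 0 by rw [map_sub, h.proj_proj hc.2.1, sub_self])
      exact ⟨w, fun _ _ _ => ⟨hw, hw'⟩⟩
    · exact ⟨0, fun h1 h2 h3 => (hc ⟨h1, h2, h3⟩).elim⟩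
  choose R hR using hex
  refine ⟨M * (1 + K), r, R, by positivity, hr0, hr1, ?_⟩
  rintro k hk j hj i hji x
  obtain ⟨h1, h2⟩ := hR k j x hk hj (by omega)
  have hMr : 0 ≤ M * r ^ i := by positivity
  refine ⟨?_, h1, h2, ?_⟩
  · refine ((H k hk j hj i hji).1 _ (h.proj_proj hk x)).trans ?_
    calc M * r ^ i * ‖P k x‖ ≤ M * r ^ i * ((1 + K) * ‖x‖) := by
          refine mul_le_mul_of_nonneg_left ((hK k hk x).trans ?_) hMr
          linarith [norm_nonneg x]
      _ = _ := by ring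
  · refine ((H k hk j hj i hji).2 _ h1).trans ?_
    rw [h2]
    calc M * r ^ i * ‖x - P j x‖ ≤ M * r ^ i * ((1 + K) * ‖x‖) := by
          refine mul_le_mul_of_nonneg_left ((norm_sub_le _ _).trans ?_) hMr
          linarith [hK j hj x]
      _ = _ := by ring

end IsExpDichotomyOn

/-! ### Solutions of the difference equation on a set of times -/

/-- `x` solves the inhomogeneous difference equation `x k = U (k, k - 1) x (k - 1) + y k` for
consecutive times `k - 1`, `k` in `J`. -/
def EvolutionFamily.SolvesOn (E : EvolutionFamily 𝕜 X) (J : Set ℤ) (x y : ℤ → X) : Prop :=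
  ∀ k, k ∈ J → k - 1 ∈ J → x k = E.discrete k (k - 1) (x (k - 1)) + y k

/-- On a half-line with a dichotomy the inhomogeneous equation has an admissible solution for every
admissible right-hand side. With `R` the backward evolution of unstable components,
`x k = ∑ i, U (k, k - i) P (k - i) y (k - i) - ∑ i, R k (k + i) y (k + i) + (1 - P k) y k`,
where only indices in `J` contribute and `i ≥ 0` in both sums; the last term
cancels the summand `i = 0` of the second sum. -/
theorem IsExpDichotomyOn.exists_admissible_solution [CompleteSpace X] {J : Set ℤ}
    {P : ℤ → X →L[𝕜] X} {E : EvolutionFamily 𝕜 X} {G : (ℤ → ℝ) → Prop} (hG : IsAdmissibleClass G)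
    (h : IsExpDichotomyOn E.discrete J P)
    (hJ : ∀ i : ℕ, {k : ℤ | k ∈ J ∧ k + i ∉ J}.Finite) {y : ℤ → X} (hy : G fun k => ‖y k‖) :
    ∃ x : ℤ → X, E.SolvesOn J x y ∧ G fun k => ‖x k‖ := by
  classical
  obtain ⟨M, r, R, hM, hr0, hr1, H⟩ := h.exists_green_kernel hJ
  obtain ⟨B, hB0, hB⟩ := hG.bounded hy
  have hsm : ∀ f : ℕ → ℤ, Summable fun i : ℕ => M * (r ^ i * ‖y (f i)‖) := fun f =>
    (summable_geometric_mul_of_bounded hr0 hr1 fun i => hB (f i)).mul_left M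
  -- the stable and the unstable summands
  set a : ℤ → ℕ → X := fun k i =>
    if k ∈ J ∧ k - i ∈ J then E.discrete k (k - i) (P (k - i) (y (k - i))) else 0 with ha
  set b : ℤ → ℕ → X := fun k i =>
    if k ∈ J ∧ k + i ∈ J then R k (k + i) (y (k + i)) else 0 with hb
  have ha_le : ∀ k i, ‖a k i‖ ≤ M * (r ^ i * ‖y (k - i)‖) := by
    intro k i
    simp only [ha]
    split_ifs with hc
    · rw [← mul_assoc]
      exact (H _ hc.2 _ hc.1 i (by ring) _).1
    · rw [norm_zero]
      positivity
  have hb_le : ∀ k i, ‖b k i‖ ≤ M * (r ^ i * ‖y (k + i)‖) := by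
    intro k i
    simp only [hb]
    split_ifs with hc
    · rw [← mul_assoc]
      exact (H _ hc.1 _ hc.2 i rfl _).2.2.2
    · rw [norm_zero]
      positivity
  have ha_sm : ∀ k, Summable (a k) := fun k => .of_norm_bounded (hsm fun i => k - i) (ha_le k)
  have hb_sm : ∀ k, Summable (b k) := fun k => .of_norm_bounded (hsm fun i => k + i) (hb_le k)
  have hstep_a : ∀ k, k ∈ J → k - 1 ∈ J → ∀ i : ℕ,
      E.discrete k (k - 1) (a (k - 1) i) = a k (i + 1) := by
    intro k hk hk1 i
    have e : k - ((i + 1 : ℕ) : ℤ) = k - 1 - i := by push_cast; ring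
    simp only [ha, hk, hk1, true_and, e]
    split_ifs
    · exact E.discrete_discrete (by omega) (by omega) _
    · exact map_zero _
  have hstep_b : ∀ k, k ∈ J → k - 1 ∈ J → ∀ i : ℕ,
      E.discrete k (k - 1) (b (k - 1) (i + 1)) = b k i := by
    intro k hk hk1 i
    have e : k - 1 + ((i + 1 : ℕ) : ℤ) = k + i := by push_cast; ring
    simp only [hb, hk, hk1, true_and, e]
    split_ifs with hc
    · -- both sides are the unstable vector at time `k` that evolves to `(1 - P) y` at `k + i`
      have h1 := H _ hk1 _ hc (i + 1) e.symm (y (k + i))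
      have h0 := H _ hk _ hc i rfl (y (k + i))
      refine (h.invertible _ hc k hk (by omega)).injOn ?_ h0.2.1 ?_
      · change P k _ = 0
        rw [h.proj_comp hk hk1 (by omega), h1.2.1, map_zero]
      · rw [E.discrete_discrete (by omega) (by omega), h1.2.2.1, h0.2.2.1]
    · exact map_zero _
  have ha0 : ∀ k, k ∈ J → a k 0 = P k (y k) := by
    intro k hk
    simp [ha, hk, E.discrete_self_apply]
  have hb0 : ∀ k, k ∈ J → b k 0 = y k - P k (y k) := by
    intro k hk
    have := (H k hk k hk 0 (by simp) (y k)).2.2.1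
    rw [E.discrete_self_apply] at this
    simp [hb, hk, this]
  refine ⟨fun k => (∑' i, a k i) - (∑' i, b k i) + b k 0, ?_, ?_⟩
  · intro k hk hk1
    have e1 : ∑' i, a k i = P k (y k) + E.discrete k (k - 1) (∑' i, a (k - 1) i) := by
      rw [(ha_sm k).tsum_eq_zero_add, ha0 k hk, (E.discrete k (k - 1)).map_tsum (ha_sm _)]
      congr 1
      exact tsum_congr fun i => (hstep_a k hk hk1 i).symm
    have e2 : E.discrete k (k - 1) (∑' i, b (k - 1) i)
        = E.discrete k (k - 1) (b (k - 1) 0) + ∑' i, b k i := by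
      rw [(hb_sm (k - 1)).tsum_eq_zero_add, map_add,
        (E.discrete k (k - 1)).map_tsum ((summable_nat_add_iff 1).2 (hb_sm _))]
      congr 1
      exact tsum_congr fun i => hstep_b k hk hk1 i
    simp only
    rw [map_add, map_sub, e1, e2, hb0 k hk]
    abel
  · have hy0 : ∀ k, 0 ≤ ‖y k‖ := fun k => norm_nonneg _
    refine hG.mono (hG.add (hG.add (hG.const_mul M (hG.conv hy hy0 hr0 hr1))
      (hG.const_mul M (hG.conv_forward hy hy0 hr0 hr1))) (hG.const_mul M hy))
      (fun k => norm_nonneg _) fun k => ?_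
    refine (norm_add_le _ _).trans (add_le_add ((norm_sub_le _ _).trans (add_le_add ?_ ?_)) ?_)
    · rw [← tsum_mul_left]
      exact tsum_of_norm_bounded (hsm fun i => k - i).hasSum (ha_le k)
    · rw [← tsum_mul_left]
      exact tsum_of_norm_bounded (hsm fun i => k + i).hasSum (hb_le k)
    · simpa using hb_le k 0

end Dichotomy

section HalfLines

variable {𝕜 X : Type*} [RCLike 𝕜] [NormedAddCommGroup X] [NormedSpace 𝕜 X]

/-! ### Homogeneous solutions on half-lines and gluing -/

namespace EvolutionFamily

variable {E : EvolutionFamily 𝕜 X}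

theorem SolvesOn.sub {J : Set ℤ} {x x' y y' : ℤ → X} (h : E.SolvesOn J x y)
    (h' : E.SolvesOn J x' y') : E.SolvesOn J (x - x') (y - y') := by
  intro k hk hk1
  simp only [Pi.sub_apply]
  rw [h k hk hk1, h' k hk hk1, map_sub]
  abel

theorem SolvesOn.mono {J J' : Set ℤ} {x y : ℤ → X} (h : E.SolvesOn J x y) (hJ : J' ⊆ J) :
    E.SolvesOn J' x y :=
  fun k hk hk1 => h k (hJ hk) (hJ hk1)

theorem solvesOn_univ_iff {x y : ℤ → X} :
    E.SolvesOn Set.univ x y ↔ ∀ k, x k - E.discrete k (k - 1) (x (k - 1)) = y k := by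
  refine forall_congr' fun k => ?_
  rw [sub_eq_iff_eq_add, add_comm (y k)]
  simp

theorem SolvesOn.eq_discrete {J : Set ℤ} {x : ℤ → X} (h : E.SolvesOn J x 0) {k j : ℤ}
    (hkj : k ≤ j) (hJ : Set.Icc k j ⊆ J) : x j = E.discrete j k (x k) := by
  induction j, hkj using Int.leInduction with
  | base => exact (E.discrete_self_apply k _).symm
  | succ j hkj ih =>
    have h1 := h (j + 1) (hJ ⟨by omega, le_rfl⟩) (hJ ⟨by omega, by omega⟩)
    rw [add_sub_cancel_right, Pi.zero_apply, add_zero,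
      ih ((Set.Icc_subset_Icc_right (by omega)).trans hJ),
      E.discrete_discrete (by omega) hkj] at h1
    exact h1

theorem SolvesOn.exists_extension {m : ℤ} {x₀ y : ℤ → X} (h : E.SolvesOn (Set.Iic m) x₀ y) :
    ∃ x, E.SolvesOn Set.univ x y ∧ ∀ k ≤ m, x k = x₀ k := by
  let f : ℕ → X := fun i => Nat.rec (x₀ m)
    (fun i v => E.discrete (m + i + 1) (m + i) v + y (m + i + 1)) i
  have hf : ∀ i : ℕ, f (i + 1) = E.discrete (m + i + 1) (m + i) (f i) + y (m + i + 1) :=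
    fun i => rfl
  refine ⟨fun k => if k ≤ m then x₀ k else f (k - m).toNat, fun k _ _ => ?_,
    fun k hk => if_pos hk⟩
  rcases lt_or_ge m k with hk | hk
  · obtain ⟨i, rfl⟩ : ∃ i : ℕ, k = m + i + 1 := ⟨(k - m - 1).toNat, by omega⟩
    have e1 : (m + i + 1 - m).toNat = i + 1 := by omega
    have e2 : m + (i : ℤ) + 1 - 1 = m + i := by ring
    simp only [if_neg (not_le.2 hk), e1, e2, hf]
    rcases Nat.eq_zero_or_pos i with rfl | hi
    · simp [f]
    · have e3 : (m + (i : ℤ) - m).toNat = i := by omega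
      rw [if_neg (by omega), e3]
  · have hk1 : k - 1 ≤ m := by omega
    simp only [if_pos hk, if_pos hk1]
    exact h k hk hk1

end EvolutionFamily

theorem finite_setOf_mem_Iic_add_notMem (m : ℤ) (i : ℕ) :
    {k : ℤ | k ∈ Set.Iic m ∧ k + i ∉ Set.Iic m}.Finite :=
  (Set.finite_Icc (m - i) m).subset fun k hk => by
    simp only [Set.mem_ofPred_eq, Set.mem_Iic, not_le] at hk
    exact ⟨by omega, hk.1⟩

theorem finite_setOf_mem_Ici_add_notMem (n : ℤ) (i : ℕ) :
    {k : ℤ | k ∈ Set.Ici n ∧ k + i ∉ Set.Ici n}.Finite := by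
  convert Set.finite_empty
  ext k
  simp only [Set.mem_ofPred_eq, Set.mem_Ici, not_le, Set.mem_empty_iff_false, iff_false, not_and]
  omega

theorem eq_zero_of_forall_le_geometric {c r C : ℝ} (hr0 : 0 < r) (hr1 : r < 1) (hc : 0 ≤ c)
    (h : ∀ i : ℕ, c ≤ C * r ^ i) : c = 0 := by
  refine le_antisymm ?_ hc
  have ht : Tendsto (fun i : ℕ => C * r ^ i) atTop (𝓝 (C * 0)) :=
    (tendsto_pow_atTop_nhds_zero_of_lt_one hr0.le hr1).const_mul C
  rw [mul_zero] at ht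
  exact ge_of_tendsto' ht h

namespace IsExpDichotomyOn

variable {E : EvolutionFamily 𝕜 X} {P : ℤ → X →L[𝕜] X} {x : ℤ → X}

/-- The stable component of a solution on a left half-line grows exponentially backward in time. -/
theorem proj_eq_zero_of_bounded {m : ℤ} (h : IsExpDichotomyOn E.discrete (Set.Iic m) P)
    (hx : E.SolvesOn (Set.Iic m) x 0) {B : ℝ} (hB : ∀ k ≤ m, ‖x k‖ ≤ B) : P m (x m) = 0 := by
  obtain ⟨M, r, R, hM, hr0, hr1, H⟩ :=
    h.exists_green_kernel (finite_setOf_mem_Iic_add_notMem m)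
  rw [← norm_eq_zero]
  refine eq_zero_of_forall_le_geometric (C := M * B) hr0 hr1 (norm_nonneg _) fun i => ?_
  have hmi : m - i ∈ Set.Iic m := by simp
  rw [hx.eq_discrete (k := m - i) (by omega) (fun k hk => hk.2),
    h.proj_comp Set.self_mem_Iic hmi hmi]
  calc _ ≤ M * r ^ i * ‖x (m - i)‖ := (H _ hmi m Set.self_mem_Iic i (by ring) _).1
    _ ≤ M * r ^ i * B := mul_le_mul_of_nonneg_left (hB _ hmi) (by positivity)
    _ = _ := by ring

/-- The unstable component of a solution on a right half-line grows exponentially. -/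
theorem proj_eq_self_of_bounded {n : ℤ} (h : IsExpDichotomyOn E.discrete (Set.Ici n) P)
    (hx : E.SolvesOn (Set.Ici n) x 0) {B : ℝ} (hB : ∀ k, n ≤ k → ‖x k‖ ≤ B) :
    P n (x n) = x n := by
  obtain ⟨M, r, R, hM, hr0, hr1, H⟩ :=
    h.exists_green_kernel (finite_setOf_mem_Ici_add_notMem n)
  refine (sub_eq_zero.1 ?_).symm
  rw [← norm_eq_zero]
  refine eq_zero_of_forall_le_geometric (C := M * B) hr0 hr1 (norm_nonneg _) fun i => ?_
  have hni : n + i ∈ Set.Ici n := by simp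
  have hn : n ∈ Set.Ici n := Set.self_mem_Ici
  obtain ⟨-, hR1, hR2, hR3⟩ := H n hn _ hni i rfl (x (n + i))
  have hxn : R n (n + i) (x (n + i)) = x n - P n (x n) := by
    refine (h.invertible _ hni n hn hni).injOn hR1 ?_ ?_
    · change P n _ = 0
      rw [map_sub, h.proj_proj hn, sub_self]
    · rw [hR2, map_sub, ← h.proj_comp hni hn hni,
        ← hx.eq_discrete hni (fun k hk => hk.1)]
  rw [← hxn]
  calc _ ≤ M * r ^ i * ‖x (n + i)‖ := hR3
    _ ≤ M * r ^ i * B := mul_le_mul_of_nonneg_left (hB _ hni) (by positivity)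
    _ = _ := by ring

variable {G : (ℤ → ℝ) → Prop}

/-- Every unstable vector has an admissible backward orbit. -/
theorem exists_admissible_backward (hG : IsAdmissibleClass G) {m : ℤ}
    (h : IsExpDichotomyOn E.discrete (Set.Iic m) P) {w : X} (hw : P m w = 0) :
    ∃ x, E.SolvesOn (Set.Iic m) x 0 ∧ x m = w ∧ G fun k => ‖x k‖ := by
  obtain ⟨M, r, R, hM, hr0, hr1, H⟩ :=
    h.exists_green_kernel (finite_setOf_mem_Iic_add_notMem m)
  have hm : m ∈ Set.Iic m := Set.self_mem_Iic
  have hR : ∀ k ≤ m, P k (R k m w) = 0 ∧ E.discrete m k (R k m w) = w ∧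
      ‖R k m w‖ ≤ M * r ^ (k - m).natAbs * ‖w‖ := by
    intro k hk
    obtain ⟨-, h1, h2, h3⟩ := H k hk m hm (k - m).natAbs (by omega) w
    exact ⟨h1, by simpa [hw] using h2, h3⟩
  refine ⟨fun k => if k ≤ m then R k m w else 0, ?_, ?_, ?_⟩
  · intro k hk hk1
    rw [Set.mem_Iic] at hk hk1
    simp only [if_pos hk, if_pos hk1, Pi.zero_apply, add_zero]
    refine (h.invertible m hm k hk hk).injOn (hR k hk).1 ?_ ?_
    · change P k _ = 0
      rw [h.proj_comp hk hk1 (by omega), (hR _ hk1).1, map_zero]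
    · rw [E.discrete_discrete hk (by omega), (hR _ hk1).2.1, (hR _ hk).2.1]
  · have := (hR m le_rfl).2.1
    rw [E.discrete_self_apply] at this
    simpa using this
  · refine hG.mono (hG.const_mul (M * ‖w‖) (hG.geometric hr0 hr1 m)) (fun k => norm_nonneg _)
      fun k => ?_
    dsimp only
    split_ifs with hk
    · exact (hR k hk).2.2.trans_eq (by ring)
    · rw [norm_zero]
      positivity

/-- A solution on `ℤ` is admissible if it agrees with an admissible sequence on a left half-line,
and on a right half-line differs at the initial time from an admissible solution by a stable
vector. -/
theorem admissible_of_glue (hG : IsAdmissibleClass G) {m n : ℤ}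
    (h : IsExpDichotomyOn E.discrete (Set.Ici n) P) {y g g' : ℤ → X}
    (hx : E.SolvesOn Set.univ x y) (hg : G fun k => ‖g k‖) (hxg : ∀ k ≤ m, x k = g k)
    (hg' : G fun k => ‖g' k‖) (hg's : E.SolvesOn (Set.Ici n) g' y)
    (hn : P n (x n - g' n) = x n - g' n) : G fun k => ‖x k‖ := by
  obtain ⟨M, r, R, hM, hr0, hr1, H⟩ :=
    h.exists_green_kernel (finite_setOf_mem_Ici_add_notMem n)
  have hd : E.SolvesOn (Set.Ici n) (x - g') 0 := by
    simpa using (hx.mono (Set.subset_univ _)).sub hg's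
  refine hG.mono (hG.add (hG.add hg (hG.sum_single (fun j => ‖x j‖) (Finset.Ioo m n)))
    (hG.add hg' (hG.const_mul (M * ‖x n - g' n‖) (hG.geometric hr0 hr1 n))))
    (fun k => norm_nonneg _) fun k => ?_
  have h1 : 0 ≤ ‖g k‖ := norm_nonneg _
  have h2 : ∀ j, 0 ≤ ‖x j‖ * (Pi.single j 1 : ℤ → ℝ) k := fun j =>
    mul_nonneg (norm_nonneg _) (by by_cases hkj : k = j <;> simp [hkj])
  have h2' : 0 ≤ ∑ j ∈ Finset.Ioo m n, ‖x j‖ * (Pi.single j 1 : ℤ → ℝ) k :=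
    Finset.sum_nonneg fun j _ => h2 j
  have h3 : 0 ≤ ‖g' k‖ := norm_nonneg _
  have h4 : 0 ≤ M * ‖x n - g' n‖ * r ^ (k - n).natAbs := by positivity
  rcases le_or_gt k m with hk | hk
  · rw [hxg k hk]
    linarith
  rcases lt_or_ge k n with hkn | hkn
  · have := Finset.single_le_sum (fun j _ => h2 j) (Finset.mem_Ioo.2 ⟨hk, hkn⟩)
    rw [Pi.single_eq_same, mul_one] at this
    linarith
  · have e := hd.eq_discrete hkn (fun j hj => hj.1)
    have hb := (H n Set.self_mem_Ici k hkn (k - n).natAbs (by omega) (x n - g' n)).1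
    simp only [Pi.sub_apply] at e
    rw [hn, ← e] at hb
    have ht : ‖x k‖ ≤ ‖g' k‖ + ‖x k - g' k‖ := by
      calc ‖x k‖ = ‖g' k + (x k - g' k)‖ := by rw [add_sub_cancel]
        _ ≤ _ := norm_add_le _ _
    have e' : M * r ^ (k - n).natAbs * ‖x n - g' n‖ = M * ‖x n - g' n‖ * r ^ (k - n).natAbs := by
      ring
    linarith

end IsExpDichotomyOn

end HalfLines

/-! ### The node operator and the difference operator -/

section Node

variable {𝕜 X : Type*} [RCLike 𝕜] [NormedAddCommGroup X] [NormedSpace 𝕜 X]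

/-- `S` is a space of sequences in `X`, with coordinates given by `coe`, which consists of the
sequences whose norms form a sequence in the class `G`. -/
structure IsSequenceSpace {S : Type*} [NormedAddCommGroup S] [NormedSpace 𝕜 S]
    (coe : S →ₗ[𝕜] (ℤ → X)) (G : (ℤ → ℝ) → Prop) : Prop where
  injective : Function.Injective coe
  admissible : ∀ s, G fun k => ‖coe s k‖
  exists_eq : ∀ x : ℤ → X, (G fun k => ‖x k‖) → ∃ s, coe s = x

variable {E : EvolutionFamily 𝕜 X} {G : (ℤ → ℝ) → Prop} {S : Type*} [NormedAddCommGroup S]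
  [NormedSpace 𝕜 S] {coe : S →ₗ[𝕜] (ℤ → X)} {D : S →L[𝕜] S}
  {m n : ℤ} {Pplus Pminus : ℤ → X →L[𝕜] X}

/-- Evaluation at `m` is an isomorphism from the space of admissible solutions on `ℤ` onto the
kernel of the node operator. -/
theorem nonempty_ker_equiv_ker_nodeOperator (hG : IsAdmissibleClass G)
    (hS : IsSequenceSpace coe G)
    (hD : ∀ s k, coe (D s) k = coe s k - E.discrete k (k - 1) (coe s (k - 1))) (hmn : m ≤ n)
    (hplus : IsExpDichotomyOn E.discrete (Set.Ici n) Pplus)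
    (hminus : IsExpDichotomyOn E.discrete (Set.Iic m) Pminus)
    (hn : IsIdempotentElem (Pplus n)) :
    Nonempty (D.ker ≃ₗ[𝕜] (nodeOperator E.discrete Pplus Pminus n m hn).ker) := by
  have hsol : ∀ s : D.ker, E.SolvesOn Set.univ (coe s) 0 := fun s => by
    rw [EvolutionFamily.solvesOn_univ_iff]
    intro k
    rw [← hD, show D s = 0 from s.2, map_zero]
  have hbd : ∀ s : D.ker, ∃ B, ∀ k, ‖coe s k‖ ≤ B := fun s => by
    obtain ⟨B, -, hB⟩ := hG.bounded (hS.admissible s)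
    exact ⟨B, fun k => (le_abs_self _).trans (hB k)⟩
  have hev : ∀ s : D.ker, coe s m ∈ (Pminus m).ker := fun s => by
    obtain ⟨B, hB⟩ := hbd s
    exact hminus.proj_eq_zero_of_bounded ((hsol s).mono (Set.subset_univ _)) fun k _ => hB k
  have hevN : ∀ s : D.ker, (⟨coe s m, hev s⟩ : (Pminus m).ker) ∈
      (nodeOperator E.discrete Pplus Pminus n m hn).ker := fun s => by
    obtain ⟨B, hB⟩ := hbd s
    have h := hplus.proj_eq_self_of_bounded ((hsol s).mono (Set.subset_univ _)) fun k _ => hB k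
    rw [(hsol s).eq_discrete hmn (Set.subset_univ _)] at h
    refine Subtype.ext ?_
    change E.discrete n m (coe s m) - Pplus n (E.discrete n m (coe s m)) = 0
    rw [h, sub_self]
  let ev : D.ker →ₗ[𝕜] (nodeOperator E.discrete Pplus Pminus n m hn).ker :=
    { toFun := fun s => ⟨⟨coe s m, hev s⟩, hevN s⟩
      map_add' := fun s t => by
        refine Subtype.ext (Subtype.ext ?_)
        exact congrFun (map_add coe (s : S) t) m
      map_smul' := fun c s => by
        refine Subtype.ext (Subtype.ext ?_)
        exact congrFun (map_smul coe c (s : S)) m }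
  refine ⟨LinearEquiv.ofBijective ev ⟨?_, ?_⟩⟩
  · rw [← LinearMap.ker_eq_bot, LinearMap.ker_eq_bot']
    intro s hs
    have hm0 : coe s m = 0 :=
      congrArg (fun v => ((v : (Pminus m).ker) : X)) (congrArg Subtype.val hs)
    obtain ⟨B, hB⟩ := hbd s
    refine Subtype.ext (hS.injective ?_)
    rw [ZeroMemClass.coe_zero, map_zero]
    funext k
    rcases le_total m k with hk | hk
    · rw [(hsol s).eq_discrete hk (Set.subset_univ _), hm0, map_zero, Pi.zero_apply]
    · -- backward in time, the solution stays in the unstable subspaces, where `U` is injective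
      have hk0 : Pminus k (coe s k) = 0 :=
        (hminus.mono (Set.Iic_subset_Iic.2 hk)).proj_eq_zero_of_bounded
          ((hsol s).mono (Set.subset_univ _)) fun k _ => hB k
      refine (hminus.invertible m Set.self_mem_Iic k hk hk).injOn hk0 (map_zero _) ?_
      rw [← (hsol s).eq_discrete hk (Set.subset_univ _), hm0, Pi.zero_apply, map_zero]
  · rintro ⟨⟨w, hw⟩, hwN⟩
    have hw' : E.discrete n m w - Pplus n (E.discrete n m w) = 0 := congrArg Subtype.val hwN
    obtain ⟨x₀, hx₀, hx₀m, hx₀G⟩ := hminus.exists_admissible_backward hG hw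
    obtain ⟨x, hx, hxx₀⟩ := hx₀.exists_extension
    have hxn : x n = E.discrete n m w := by
      rw [hx.eq_discrete hmn (Set.subset_univ _), hxx₀ m le_rfl, hx₀m]
    obtain ⟨s, rfl⟩ := hS.exists_eq x <|
      hplus.admissible_of_glue hG (g' := 0) hx hx₀G hxx₀
        (by simp only [Pi.zero_apply, norm_zero]; exact hG.zero)
        (fun k _ _ => by simp) (by simpa [hxn] using (sub_eq_zero.1 hw').symm)
    refine ⟨⟨s, hS.injective ?_⟩, ?_⟩
    · rw [map_zero]
      funext k
      exact (hD s k).trans (EvolutionFamily.solvesOn_univ_iff.1 hx k)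
    · exact Subtype.ext (Subtype.ext ((hxx₀ m le_rfl).trans hx₀m))

/-- The map sending `z` in the unstable subspace at time `n` to the right-hand side supported at
time `n + 1` with value `U (n + 1, n) z` induces an isomorphism from the cokernel of the node
operator onto the cokernel of `D`. -/
theorem nonempty_coker_nodeOperator_equiv_coker [CompleteSpace X] (hG : IsAdmissibleClass G)
    (hS : IsSequenceSpace coe G)
    (hD : ∀ s k, coe (D s) k = coe s k - E.discrete k (k - 1) (coe s (k - 1))) (hmn : m ≤ n)
    (hplus : IsExpDichotomyOn E.discrete (Set.Ici n) Pplus)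
    (hminus : IsExpDichotomyOn E.discrete (Set.Iic m) Pminus)
    (hn : IsIdempotentElem (Pplus n)) :
    Nonempty (((Pplus n).ker ⧸ (nodeOperator E.discrete Pplus Pminus n m hn).range) ≃ₗ[𝕜]
      (S ⧸ D.range)) := by
  classical
  let δ : (Pplus n).ker →ₗ[𝕜] (ℤ → X) :=
    (LinearMap.single 𝕜 (fun _ : ℤ => X) (n + 1)) ∘ₗ
      ((E.discrete (n + 1) n).toLinearMap ∘ₗ (Pplus n).ker.subtype)
  have hδ : ∀ z : (Pplus n).ker, δ z = Pi.single (n + 1) (E.discrete (n + 1) n z) := fun z => rfl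
  have hδ_self : ∀ z : (Pplus n).ker, δ z (n + 1) = E.discrete (n + 1) n z := fun z => by
    rw [hδ, Pi.single_eq_same]
  have hδ_ne : ∀ (z : (Pplus n).ker) (k : ℤ), k ≠ n + 1 → δ z k = 0 := fun z k hk => by
    rw [hδ, Pi.single_eq_of_ne hk]
  have hδG : ∀ z, G fun k => ‖δ z k‖ := fun z => by
    refine hG.mono (hG.const_mul ‖E.discrete (n + 1) n z‖ (hG.single (n + 1)))
      (fun k => norm_nonneg _) fun k => ?_
    by_cases hk : k = n + 1
    · subst hk
      simp [hδ_self]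
    · simp [hδ_ne z k hk, hk]
  -- a jump by `-z` at time `n` solves the equation with right-hand side `δ z` after time `n`
  have hjump : ∀ z : (Pplus n).ker,
      E.SolvesOn (Set.Ici n) (Pi.single n (-(z : X))) (δ z) := fun z k hk hk1 => by
    rw [Set.mem_Ici] at hk hk1
    rw [Pi.single_eq_of_ne (by omega)]
    by_cases hkn : k = n + 1
    · subst hkn
      rw [hδ_self]
      simp
    · rw [hδ_ne z k hkn, Pi.single_eq_of_ne (by omega), map_zero, add_zero]
  have hjumpG : ∀ z : X, G fun k => ‖(Pi.single n (-z) : ℤ → X) k‖ := fun z => by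
    refine hG.mono (hG.const_mul ‖z‖ (hG.single n)) (fun k => norm_nonneg _) fun k => ?_
    by_cases hk : k = n
    · subst hk
      simp
    · simp [hk]
  let ι : (Pplus n).ker →ₗ[𝕜] S :=
    (LinearEquiv.ofInjective coe hS.injective).symm.toLinearMap ∘ₗ
      δ.codRestrict (LinearMap.range coe) fun z => hS.exists_eq _ (hδG z)
  have hι : ∀ z, coe (ι z) = δ z := fun z =>
    congrArg Subtype.val ((LinearEquiv.ofInjective coe hS.injective).apply_symm_apply _)
  have hmem : ∀ s, s ∈ D.range ↔ ∃ x : ℤ → X, E.SolvesOn Set.univ x (coe s) ∧ G fun k => ‖x k‖ := by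
    refine fun s => ⟨?_, ?_⟩
    · rintro ⟨t, rfl⟩
      exact ⟨coe t, EvolutionFamily.solvesOn_univ_iff.2 fun k => (hD t k).symm, hS.admissible t⟩
    · rintro ⟨x, hx, hxG⟩
      obtain ⟨t, rfl⟩ := hS.exists_eq x hxG
      refine ⟨t, hS.injective (funext fun k => ?_)⟩
      exact (hD t k).trans (EvolutionFamily.solvesOn_univ_iff.1 hx k)
  -- `ι z` lies in the range of `D` exactly if `z` lies in the range of the node operator
  have hker : LinearMap.ker (D.range.mkQ ∘ₗ ι) =
      (nodeOperator E.discrete Pplus Pminus n m hn).range := by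
    ext z
    rw [LinearMap.mem_ker, LinearMap.comp_apply, Submodule.mkQ_apply,
      Submodule.Quotient.mk_eq_zero, hmem, hι]
    have hz : Pplus n (z : X) = 0 := z.2
    constructor
    · rintro ⟨x, hx, hxG⟩
      obtain ⟨B, -, hB⟩ := hG.bounded hxG
      have hx0 : E.SolvesOn (Set.Iic n) x 0 := fun k hk hk1 => by
        rw [hx k trivial trivial, hδ_ne z k (by rw [Set.mem_Iic] at hk; omega), Pi.zero_apply]
      have hxm : Pminus m (x m) = 0 :=
        hminus.proj_eq_zero_of_bounded (hx0.mono (Set.Iic_subset_Iic.2 hmn)) fun k _ =>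
          (le_abs_self _).trans (hB k)
      have hxn : x n = E.discrete n m (x m) := hx0.eq_discrete hmn fun k hk => hk.2
      have hstable : Pplus n (x n + z) = x n + z := by
        have h := hplus.proj_eq_self_of_bounded (x := x - Pi.single n (-(z : X)))
          (by simpa using (hx.mono (Set.subset_univ _)).sub (hjump z)) (B := B + ‖(z : X)‖)
          (fun k _ => by
            refine (norm_sub_le _ _).trans (add_le_add ((le_abs_self _).trans (hB k)) ?_)
            by_cases hk : k = n
            · subst hk
              simp
            · simp [hk])
        simpa using h
      refine ⟨-⟨x m, hxm⟩, Subtype.ext ?_⟩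
      change E.discrete n m (-x m) - Pplus n (E.discrete n m (-x m)) = z
      rw [map_add, hz, add_zero] at hstable
      rw [map_neg, map_neg, ← hxn, hstable]
      abel
    · rintro ⟨w, hw⟩
      have hw' : E.discrete n m w - Pplus n (E.discrete n m w) = z := congrArg Subtype.val hw
      have hwP : Pminus m (w : X) = 0 := w.2
      obtain ⟨x₀, hx₀, hx₀m, hx₀G⟩ :=
        hminus.exists_admissible_backward hG (w := -(w : X)) (by rw [map_neg, hwP, neg_zero])
      have hx₀' : E.SolvesOn (Set.Iic m) x₀ (δ z) := fun k hk hk1 => by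
        rw [hx₀ k hk hk1, hδ_ne z k (by rw [Set.mem_Iic] at hk; omega), Pi.zero_apply]
      obtain ⟨x, hx, hxx₀⟩ := hx₀'.exists_extension
      have hx0 : E.SolvesOn (Set.Iic n) x 0 := fun k hk hk1 => by
        rw [hx k trivial trivial, hδ_ne z k (by rw [Set.mem_Iic] at hk; omega), Pi.zero_apply]
      have hxn : x n = -E.discrete n m w := by
        rw [hx0.eq_discrete hmn fun k hk => hk.2, hxx₀ m le_rfl, hx₀m, map_neg]
      refine ⟨x, hx, hplus.admissible_of_glue hG hx hx₀G hxx₀ (hjumpG z) (hjump z) ?_⟩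
      rw [hxn, Pi.single_eq_same, ← hw']
      have e : -E.discrete n m w - -(E.discrete n m w - Pplus n (E.discrete n m w))
          = -Pplus n (E.discrete n m w) := by abel
      rw [e, map_neg, hplus.proj_proj Set.self_mem_Ici]
  -- every right-hand side is solvable up to a correction in the range of `ι`
  have hsurj : Function.Surjective (D.range.mkQ ∘ₗ ι) := by
    intro q
    obtain ⟨s, rfl⟩ := Submodule.mkQ_surjective _ q
    obtain ⟨g, hg, hgG⟩ := hminus.exists_admissible_solution hG
      (finite_setOf_mem_Iic_add_notMem m) (hS.admissible s)
    obtain ⟨g', hg', hgG'⟩ := hplus.exists_admissible_solution hG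
      (finite_setOf_mem_Ici_add_notMem n) (hS.admissible s)
    obtain ⟨x', hx', hxg⟩ := hg.exists_extension
    have hzP : Pplus n ((x' n - g' n) - Pplus n (x' n - g' n)) = 0 := by
      rw [map_sub, hplus.proj_proj Set.self_mem_Ici, sub_self]
    let z : (Pplus n).ker := ⟨(x' n - g' n) - Pplus n (x' n - g' n), hzP⟩
    have hx'' : E.SolvesOn (Set.Iic n) x' (coe s - δ z) := fun k hk hk1 => by
      rw [hx' k trivial trivial, Pi.sub_apply,
        hδ_ne z k (by rw [Set.mem_Iic] at hk; omega), sub_zero]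
    obtain ⟨x, hx, hxx'⟩ := hx''.exists_extension
    refine ⟨z, ?_⟩
    rw [LinearMap.comp_apply, eq_comm, ← sub_eq_zero, ← map_sub, Submodule.mkQ_apply,
      Submodule.Quotient.mk_eq_zero, hmem, map_sub, hι]
    refine ⟨x, hx, hplus.admissible_of_glue hG (g' := g' - Pi.single n (-(z : X))) hx hgG
      (fun k hk => (hxx' k (hk.trans hmn)).trans (hxg k hk)) ?_ (hg'.sub (hjump z)) ?_⟩
    · exact hG.mono (hG.add hgG' (hjumpG z)) (fun k => norm_nonneg _) fun k => norm_sub_le _ _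
    · have e : x n - (g' - Pi.single n (-(z : X)) : ℤ → X) n = Pplus n (x' n - g' n) := by
        rw [hxx' n le_rfl, Pi.sub_apply, Pi.single_eq_same]
        change x' n - (g' n - -((x' n - g' n) - Pplus n (x' n - g' n))) = _
        abel
      rw [e, hplus.proj_proj Set.self_mem_Ici]
  exact ⟨(Submodule.quotEquivOfEq _ _ hker.symm).trans
    (LinearMap.quotKerEquivOfSurjective _ hsurj)⟩

theorem isFredholm_nodeOperator_and_sameDefects [CompleteSpace X] (hG : IsAdmissibleClass G)
    (hS : IsSequenceSpace coe G)
    (hD : ∀ s k, coe (D s) k = coe s k - E.discrete k (k - 1) (coe s (k - 1))) (hmn : m ≤ n)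
    (hplus : IsExpDichotomyOn E.discrete (Set.Ici n) Pplus)
    (hminus : IsExpDichotomyOn E.discrete (Set.Iic m) Pminus)
    (hn : IsIdempotentElem (Pplus n)) (hF : D.IsFredholm) :
    (nodeOperator E.discrete Pplus Pminus n m hn).IsFredholm ∧
      SameDefects D (nodeOperator E.discrete Pplus Pminus n m hn) := by
  obtain ⟨e₁⟩ := nonempty_ker_equiv_ker_nodeOperator hG hS hD hmn hplus hminus hn
  obtain ⟨e₂⟩ := nonempty_coker_nodeOperator_equiv_coker hG hS hD hmn hplus hminus hn
  have hker := hF.finite_ker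
  have hcoker : Module.Finite 𝕜 (S ⧸ D.range) := hF.finite_coker
  have : CompleteSpace (Pplus n).ker := (Pplus n).isClosed_ker.completeSpace_coe
  have : CompleteSpace (Pminus m).ker := (Pminus m).isClosed_ker.completeSpace_coe
  have h1 : dimKer D = dimKer (nodeOperator E.discrete Pplus Pminus n m hn) := e₁.finrank_eq
  have h2 : codimRange D = codimRange (nodeOperator E.discrete Pplus Pminus n m hn) :=
    e₂.finrank_eq.symm
  refine ⟨ContinuousLinearMap.isFredholm_of_finite_ker_of_finite_coker _ ?_ ?_, h1, h2, ?_⟩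
  · exact Module.Finite.equiv e₁
  · exact Module.Finite.equiv e₂.symm
  · rw [fredholmIndex, fredholmIndex, h1, h2]

end Node

theorem mainTheorem5 {𝕜 X : Type*} [RCLike 𝕜] [NormedAddCommGroup X] [NormedSpace 𝕜 X]
    [CompleteSpace X] (E : EvolutionFamily 𝕜 X) (a b : ℤ) (hab : a ≤ b)
    (Pplus Pminus : ℤ → X →L[𝕜] X)
    (hplus : IsExpDichotomyOn E.discrete (Set.Ici b) Pplus)
    (hminus : IsExpDichotomyOn E.discrete (Set.Iic a) Pminus) :
    (∀ (p : ℝ≥0∞) [Fact (1 ≤ p)] (hp : p ≠ ∞), (E.lpDiff p hp).IsFredholm →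
      ∀ (n m : ℤ) (hn : b ≤ n), m ≤ a →
        (nodeOperator E.discrete Pplus Pminus n m (hplus.isIdempotentElem n hn)).IsFredholm ∧
        SameDefects (E.lpDiff p hp)
          (nodeOperator E.discrete Pplus Pminus n m (hplus.isIdempotentElem n hn))) ∧
    (E.c0Diff.IsFredholm →
      ∀ (n m : ℤ) (hn : b ≤ n), m ≤ a →
        (nodeOperator E.discrete Pplus Pminus n m (hplus.isIdempotentElem n hn)).IsFredholm ∧
        SameDefects E.c0Diff
          (nodeOperator E.discrete Pplus Pminus n m (hplus.isIdempotentElem n hn))) := by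
  constructor
  · intro p hp1 hp hF n m hn hm
    have hp0 : 0 < p.toReal := ENNReal.toReal_pos (zero_lt_one.trans_le hp1.out).ne' hp
    let coe : lp (fun _ : ℤ => X) p →ₗ[𝕜] (ℤ → X) :=
      { toFun := fun x => x
        map_add' := fun _ _ => rfl
        map_smul' := fun _ _ => rfl }
    have hnorm : ∀ x : ℤ → X, Memℓp (fun k => ‖x k‖) p ↔ Memℓp x p := fun x => by
      simp_rw [memℓp_gen_iff hp0, norm_norm]
    have hS : IsSequenceSpace coe fun u : ℤ → ℝ => Memℓp u p :=
      { injective := fun x y h => lp.ext h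
        admissible := fun x => (hnorm _).2 (lp.memℓp x)
        exists_eq := fun x hx => ⟨⟨x, (hnorm x).1 hx⟩, rfl⟩ }
    exact isFredholm_nodeOperator_and_sameDefects (isAdmissibleClass_lp hp1.out hp) hS
      (E.lpDiff_apply p hp) (hm.trans (hab.trans hn)) (hplus.mono (Set.Ici_subset_Ici.2 hn))
      (hminus.mono (Set.Iic_subset_Iic.2 hm)) _ hF
  · intro hF n m hn hm
    let coe : C₀(ℤ, X) →ₗ[𝕜] (ℤ → X) :=
      { toFun := fun x => x
        map_add' := fun _ _ => rfl
        map_smul' := fun _ _ => rfl }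
    have hS : IsSequenceSpace coe fun u : ℤ → ℝ => Tendsto u cofinite (𝓝 0) :=
      { injective := fun x y h => DFunLike.coe_injective h
        admissible := fun x => by
          have h := zero_at_infty x
          rw [cocompact_eq_cofinite] at h
          exact tendsto_zero_iff_norm_tendsto_zero.1 h
        exists_eq := fun x hx => by
          refine ⟨⟨⟨x, continuous_of_discreteTopology⟩, ?_⟩, rfl⟩
          rw [cocompact_eq_cofinite]
          exact tendsto_zero_iff_norm_tendsto_zero.2 hx }
    exact isFredholm_nodeOperator_and_sameDefects isAdmissibleClass_c0 hS E.c0Diff_apply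
      (hm.trans (hab.trans hn)) (hplus.mono (Set.Ici_subset_Ici.2 hn))
      (hminus.mono (Set.Iic_subset_Iic.2 hm)) _ hF
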